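/- Let $R$ be a Gorenstein local ring, i.e. a commutative Noetherian local ring of finite injective dimension as a module over itself. All modules are finitely generated. An $R$-module $M$ is maximal Cohen-Macaulay (MCM) if $\operatorname{depth} M\ge\dim R$, where the depth of a nonzero module is the maximal length of an $M$-regular sequence in the maximal ideal and the zero module has depth $\infty$. For $R$-modules $M,N$ let $\underline{\mathrm{Hom}}_R(M,N)=\mathrm{Hom}_R(M,N)/P(M,N)$, where $P(M,N)$ consists of the homomorphisms that factor through a projective module, and let $\underline{\mathrm{ann}}_R M=\mathrm{ann}_R\,\underline{\mathrm{End}}_R(M)$ be the stable annihilator of $M$. The stable category $\underline{\mathrm{MCM}}(R)$ has the MCM $R$-modules as objects and $\underline{\mathrm{Hom}}_R$ as morphisms. Let $\mathfrak{CM}(R)$ be the set of isomorphism classes of objects of $\underline{\mathrm{MCM}}(R)$ with the preorder $N\le M\iff\underline{\mathrm{ann}}_R N\subseteq\underline{\mathrm{ann}}_R M$, equipped with the Alexandrov topology whose closed sets are the lower sets, so that the closure of a point $M$ is $\{N : N\le M\}$. The cohomology annihilator ideal $\mathrm{ca}(R)$ is the set of all $r\in R$ that lie in $\underline{\mathrm{ann}}_R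 M$ for every MCM $R$-module $M$. **Theorem.** Let $R$ be a Gorenstein local ring and let $x\in\mathrm{ca}(R)$ be a nonzerodivisor that is not a unit (so that $R/xR\neq 0$). Then $R/xR$ is a Gorenstein local ring, $M/xM$ is an MCM $R/xR$-module for every MCM $R$-module $M$, the assignment $M\mapsto M/xM$ induces a well-defined map $\pi:\mathfrak{CM}(R)\to\mathfrak{CM}(R/xR)$, and $\pi$ is continuous. Equivalently to continuity, for all MCM $R$-modules $L$ and $M$, $$\underline{\mathrm{ann}}_R L\subseteq\underline{\mathrm{ann}}_R M\implies \underline{\mathrm{ann}}_{R/xR}(L/xL)\subseteq\underline{\mathrm{ann}}_{R/xR}(M/xM).$$ -/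

import Mathlib

open CategoryTheory

universe u v w

noncomputable section

/-! ### Alexandrov spaces of linear categories -/

section Alexandrov

variable (R : Type u) [CommRing R] (T : Type v) [Category.{w} T] [Preadditive T] [Linear R T]

/-- The annihilator `ann_R X = ann_R End_T(X)` of an object of an `R`-linear category. -/
def objAnnihilator {T : Type v} [Category.{w} T] [Preadditive T] [Linear R T] (X : T) : Ideal R :=
  Module.annihilator R (X ⟶ X)

/-- Isomorphic objects have the same annihilator. -/
theorem objAnnihilator_eq_of_iso {T : Type v} [Category.{w} T] [Preadditive T] [Linear R T]
    {X Y : T} (e : X ≅ Y) : objAnnihilator R X = objAnnihilator R Y := by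
  have key : ∀ {A B : T}, (A ≅ B) → objAnnihilator R A ≤ objAnnihilator R B := by
    intro A B i r hr
    rw [objAnnihilator, Module.mem_annihilator] at hr ⊢
    intro f
    have h := congrArg (fun g => i.inv ≫ g ≫ i.hom) (hr (i.hom ≫ f ≫ i.inv))
    simpa using h
  exact le_antisymm (key e) (key e.symm)

/-- The points of the Alexandrov space `𝒜(T)`: the isomorphism classes of objects of `T`. -/
def AlexandrovSpace : Type v := Quotient (isIsomorphicSetoid T)

variable {T} in
/-- The isomorphism class of an object, as a point of `𝒜(T)`. -/
def AlexandrovSpace.mk (X : T) : AlexandrovSpace T := Quotient.mk (isIsomorphicSetoid T) X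

/-- The annihilator of an isomorphism class. -/
def AlexandrovSpace.ann : AlexandrovSpace T → Ideal R :=
  Quotient.lift (fun X => objAnnihilator R X) fun _ _ ⟨e⟩ => objAnnihilator_eq_of_iso R e

/-- The preorder `N ≤ M ↔ ann_R N ⊆ ann_R M`. -/
@[reducible]
def AlexandrovSpace.preorder : Preorder (AlexandrovSpace T) :=
  Preorder.lift (AlexandrovSpace.ann R T)

/-- The Alexandrov topology on `𝒜(T)`: the closed sets are the lower sets of the preorder
(so the closure of a point `a` is `{b | b ≤ a}`), that is, the open sets are the upper sets. -/
@[reducible]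
def AlexandrovSpace.topology : TopologicalSpace (AlexandrovSpace T) :=
  @Topology.upperSet (AlexandrovSpace T) (AlexandrovSpace.preorder R T)

end Alexandrov

/-! ### Stable homomorphisms and stable annihilators -/

section Stable

variable (R : Type u) [CommRing R]

/-- `P(M, N)`: the submodule of those homomorphisms `M → N` that factor through a (finitely
generated) projective module. -/
def projectiveHom (M N : Type u) [AddCommGroup M] [Module R M] [AddCommGroup N] [Module R N] :
    Submodule R (M →ₗ[R] N) where
  carrier := {f | ∃ (P : Type u) (_ : AddCommGroup P) (_ : Module R P),
    Module.Finite R P ∧ Module.Projective R P ∧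
      ∃ (a : M →ₗ[R] P) (b : P →ₗ[R] N), f = b ∘ₗ a}
  zero_mem' := ⟨PUnit, inferInstance, inferInstance, inferInstance, inferInstance, 0, 0, by simp⟩
  add_mem' := by
    rintro _ _ ⟨P, _, _, _, _, a, b, rfl⟩ ⟨Q, _, _, _, _, c, d, rfl⟩
    refine ⟨P × Q, inferInstance, inferInstance, inferInstance, inferInstance,
      a.prod c, b.coprod d, ?_⟩
    ext m
    simp
  smul_mem' := by
    rintro r _ ⟨P, _, _, h₁, h₂, a, b, rfl⟩
    exact ⟨P, _, _, h₁, h₂, a, r • b, by ext m; simp⟩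

variable {R} in
theorem comp_mem_projectiveHom_of_left {L M N : Type u} [AddCommGroup L] [Module R L]
    [AddCommGroup M] [Module R M] [AddCommGroup N] [Module R N] {g : M →ₗ[R] N}
    (hg : g ∈ projectiveHom R M N) (f : L →ₗ[R] M) : g ∘ₗ f ∈ projectiveHom R L N := by
  obtain ⟨P, _, _, h₁, h₂, a, b, rfl⟩ := hg
  exact ⟨P, _, _, h₁, h₂, a ∘ₗ f, b, rfl⟩

variable {R} in
theorem comp_mem_projectiveHom_of_right {L M N : Type u} [AddCommGroup L] [Module R L]
    [AddCommGroup M] [Module R M] [AddCommGroup N] [Module R N] (g : M →ₗ[R] N)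
    {f : L →ₗ[R] M} (hf : f ∈ projectiveHom R L M) : g ∘ₗ f ∈ projectiveHom R L N := by
  obtain ⟨P, _, _, h₁, h₂, a, b, rfl⟩ := hf
  exact ⟨P, _, _, h₁, h₂, a, g ∘ₗ b, rfl⟩

/-- `\underline{Hom}_R(M, N) = Hom_R(M, N) / P(M, N)`. -/
abbrev StableHom (M N : Type u) [AddCommGroup M] [Module R M] [AddCommGroup N] [Module R N] :
    Type u :=
  (M →ₗ[R] N) ⧸ projectiveHom R M N

/-- The stable annihilator: the annihilator of the stable endomorphism ring of `M`. -/
def stableAnnihilator (M : Type u) [AddCommGroup M] [Module R M] : Ideal R :=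
  Module.annihilator R (StableHom R M M)

variable {R} in
/-- Composition of stable homomorphisms, induced by composition of linear maps. -/
def StableHom.comp {L M N : Type u} [AddCommGroup L] [Module R L]
    [AddCommGroup M] [Module R M] [AddCommGroup N] [Module R N] :
    StableHom R M N → StableHom R L M → StableHom R L N :=
  Quotient.map₂ (fun g f => g ∘ₗ f) (by
    intro g g' hg f f' hf
    rw [← Quotient.eq_iff_equiv] at hg hf ⊢
    have hg' := (Submodule.Quotient.eq _).1 hg
    have hf' := (Submodule.Quotient.eq _).1 hf
    refine (Submodule.Quotient.eq _).2 ?_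
    have h := add_mem (comp_mem_projectiveHom_of_left hg' f)
      (comp_mem_projectiveHom_of_right g' hf')
    convert h using 1
    ext m
    simp)

end Stable

/-! ### Maximal Cohen-Macaulay modules over Gorenstein local rings -/

section MCM

/-- A quotient of a local ring is local as soon as it is nonzero. -/
instance isLocalRing_quotient_of_nontrivial (R : Type u) [CommRing R] [IsLocalRing R]
    (I : Ideal R) [Nontrivial (R ⧸ I)] : IsLocalRing (R ⧸ I) :=
  IsLocalRing.of_surjective' (Ideal.Quotient.mk I) Ideal.Quotient.mk_surjective

/-- A Gorenstein local ring: a Noetherian local ring of finite injective dimension over itself. -/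
class IsGorensteinLocalRing (R : Type u) [CommRing R] : Prop
    extends IsLocalRing R, IsNoetherianRing R where
  exists_hasInjectiveDimensionLE : ∃ n : ℕ, HasInjectiveDimensionLE (ModuleCat.of R R) n

variable (R : Type u) [CommRing R] [IsLocalRing R]

open scoped Classical in
/-- The depth of a module over a local ring: the supremum of the lengths of the `M`-regular
sequences in the maximal ideal, and `∞` for the zero module. -/
def moduleDepth (M : Type u) [AddCommGroup M] [Module R M] : ℕ∞ :=
  if Subsingleton M then ⊤ else
    ⨆ (rs : List R) (_ : (∀ r ∈ rs, r ∈ IsLocalRing.maximalIdeal R) ∧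
      RingTheory.Sequence.IsRegular M rs), (rs.length : ℕ∞)

/-- A maximal Cohen-Macaulay module: finitely generated with `depth M ≥ dim R`. -/
structure IsMaximalCohenMacaulay (M : Type u) [AddCommGroup M] [Module R M] : Prop where
  finite : Module.Finite R M
  dim_le_depth : ringKrullDim R ≤ (moduleDepth R M : WithBot ℕ∞)

/-- The objects of the stable category of maximal Cohen-Macaulay `R`-modules: they are the
maximal Cohen-Macaulay `R`-modules. -/
structure StableMCM : Type (u + 1) where
  carrier : Type u
  [addCommGroup : AddCommGroup carrier]
  [module : Module R carrier]
  isMaximalCohenMacaulay : IsMaximalCohenMacaulay R carrier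

attribute [instance] StableMCM.addCommGroup StableMCM.module

/-- The stable category: the morphisms are the stable homomorphisms. -/
instance : Category (StableMCM R) where
  Hom M N := StableHom R M.carrier N.carrier
  id M := Submodule.Quotient.mk LinearMap.id
  comp f g := StableHom.comp g f
  id_comp := by rintro M N ⟨f⟩; rfl
  comp_id := by rintro M N ⟨f⟩; rfl
  assoc := by rintro M N K L ⟨f⟩ ⟨g⟩ ⟨h⟩; rfl

instance : Preadditive (StableMCM R) where
  homGroup M N := inferInstanceAs (AddCommGroup (StableHom R M.carrier N.carrier))
  add_comp := by
    rintro M N K ⟨f⟩ ⟨f'⟩ ⟨g⟩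
    exact congrArg Submodule.Quotient.mk (LinearMap.comp_add f f' g)
  comp_add := by
    rintro M N K ⟨f⟩ ⟨g⟩ ⟨g'⟩
    exact congrArg Submodule.Quotient.mk (LinearMap.add_comp f g' g)

instance : Linear R (StableMCM R) where
  homModule M N := inferInstanceAs (Module R (StableHom R M.carrier N.carrier))
  smul_comp := by
    rintro M N K r ⟨f⟩ ⟨g⟩
    exact congrArg Submodule.Quotient.mk (LinearMap.comp_smul g r f)
  comp_smul := by
    rintro M N K ⟨f⟩ r ⟨g⟩
    exact congrArg Submodule.Quotient.mk (LinearMap.smul_comp r g f)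

/-- In the stable category the annihilator of an object is its stable annihilator. -/
theorem objAnnihilator_stableMCM (M : StableMCM R) :
    objAnnihilator R M = stableAnnihilator R M.carrier := rfl

/-- The cohomology annihilator ideal `ca(R)`: the elements that lie in the stable annihilator of
every maximal Cohen-Macaulay module. -/
def cohomologyAnnihilator : Ideal R :=
  ⨅ M : StableMCM R, stableAnnihilator R M.carrier

/-- The space `ℭ𝔐(R)`: the Alexandrov space of the stable category of maximal Cohen-Macaulay
`R`-modules. -/
def CMSpace : Type (u + 1) := AlexandrovSpace (StableMCM R)

instance : TopologicalSpace (CMSpace R) := AlexandrovSpace.topology R (StableMCM R)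

variable {R} in
/-- The point of `ℭ𝔐(R)` given by a maximal Cohen-Macaulay module `M`. -/
def CMSpace.mk (M : Type u) [AddCommGroup M] [Module R M] (hM : IsMaximalCohenMacaulay R M) :
    CMSpace R :=
  AlexandrovSpace.mk (T := StableMCM R) ⟨M, hM⟩

end MCM

end

/-! ### Vanishing of `Ext` into a finitely generated module over a local ring -/

section ExtVanishing

open CategoryTheory.Abelian

/-! For an MCM module `M`, a class in `R/xR` kills the stable endomorphisms of `M/xM` exactly when
its lifts kill those of `M` (`mk_mem_stableAnnihilator_quotSMulTop_iff`). The preorder by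
annihilators is therefore preserved, and monotone maps are continuous for Alexandrov topologies.

One direction reduces a factorization modulo `x`. For the other, suppose `r • id` on `M/xM` factors
as `b ∘ a` through a free `R/xR`-module. The map `b` lifts to `B` by freeness, and `a` lifts to `A`
because `Ext¹(M, R) = 0`. Then `r • id - B ∘ A` has image in `xM`, so it equals `x • G` because `x`
is regular on `M`. As `x` stably annihilates `M`, `x • G` factors through a projective, hence so
does `r • id`.

The vanishing of `Ext¹(M, R)` comes from Nakayama along a regular sequence on `M` of length at least
`dim R`, once `Ext^n(-, R)` is known to vanish on finite modules for `n > dim R`. That bound is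
reached by descending induction from the finite injective dimension. The ring `R/xR` is Gorenstein
because it is a retract of the `x`-torsion of `E/R`, for `E` an injective module containing `R`.
Regularity of `x` on `M` is a chain-length argument with associated primes, and the depth of `M/xM`
is read off from `Ext(k, -)`, with `k` the residue field. -/

theorem ext_eq_zero_of_subsingleton {C : Type u} [Category.{v} C] [Abelian C] [HasExt.{w} C]
    {X Y : C} {n : ℕ} (h : Subsingleton (Ext X Y n)) (e : Ext X Y n) : e = 0 :=
  Subsingleton.elim _ _

section ShortExact

variable {C : Type u} [Category.{v} C] [Abelian C] [HasExt.{w} C] {S : ShortComplex C}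

theorem subsingleton_ext_X₂ (hS : S.ShortExact) {Y : C} {n : ℕ}
    (h₁ : Subsingleton (Ext S.X₁ Y n)) (h₃ : Subsingleton (Ext S.X₃ Y n)) :
    Subsingleton (Ext S.X₂ Y n) := by
  refine subsingleton_of_forall_eq 0 fun e => ?_
  obtain ⟨e', rfl⟩ := Ext.contravariant_sequence_exact₂ hS Y e (Subsingleton.elim _ _)
  rw [ext_eq_zero_of_subsingleton h₃ e', Ext.comp_zero]

theorem subsingleton_ext_X₁ (hS : S.ShortExact) {Y : C} {n : ℕ}
    (h₂ : Subsingleton (Ext S.X₂ Y n)) (h₃ : Subsingleton (Ext S.X₃ Y (n + 1))) :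
    Subsingleton (Ext S.X₁ Y n) := by
  refine subsingleton_of_forall_eq 0 fun e => ?_
  obtain ⟨e', rfl⟩ := Ext.contravariant_sequence_exact₁ hS Y e (add_comm 1 n)
    (Subsingleton.elim _ _)
  rw [ext_eq_zero_of_subsingleton h₂ e', Ext.comp_zero]

theorem subsingleton_ext_of_iso {X X' Y : C} {n : ℕ} (e : X ≅ X')
    (h : Subsingleton (Ext X Y n)) : Subsingleton (Ext X' Y n) := by
  refine subsingleton_of_forall_eq 0 fun a => ?_
  have : (Ext.mk₀ e.inv).comp ((Ext.mk₀ e.hom).comp a (zero_add n)) (zero_add n) = a := by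
    rw [Ext.mk₀_comp_mk₀_assoc, e.inv_hom_id, Ext.mk₀_id_comp]
  rw [← this, ext_eq_zero_of_subsingleton h ((Ext.mk₀ e.hom).comp a _), Ext.comp_zero]

theorem subsingleton_ext_of_isZero {X Y : C} {n : ℕ} (h : Limits.IsZero X) :
    Subsingleton (Ext X Y n) := by
  refine subsingleton_of_forall_eq 0 fun a => ?_
  rw [← Ext.mk₀_id_comp a, h.eq_of_src (𝟙 X) 0, Ext.mk₀_zero, Ext.zero_comp]

end ShortExact

variable {R : Type u} [CommRing R] [IsNoetherianRing R] [IsLocalRing R]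

/-- Nakayama's lemma for `Ext`. -/
theorem subsingleton_ext_of_quotSMulTop {M N : ModuleCat.{u} R} [Module.Finite R M]
    [Module.Finite R N] {n : ℕ} {y : R} (hy : y ∈ IsLocalRing.maximalIdeal R)
    (hreg : IsSMulRegular M y)
    (h : Subsingleton (Ext (ModuleCat.of R (QuotSMulTop y M)) N (n + 1))) :
    Subsingleton (Ext M N n) := by
  have hS := hreg.smulShortComplex_shortExact
  -- Multiplication by `y` is onto, because its cokernel embeds in `Ext^{n+1}(M/yM, N) = 0`.
  have hsurj : ∀ e : Ext M N n, ∃ e' : Ext M N n, y • e' = e := by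
    intro e
    obtain ⟨e', he'⟩ := Ext.contravariant_sequence_exact₁ hS N e (add_comm 1 n)
      (ext_eq_zero_of_subsingleton h _)
    refine ⟨e', ?_⟩
    rw [← he']
    rw [ModuleCat.smulShortComplex_f_eq_smul_id]
    erw [Ext.mk₀_smul, Ext.smul_comp, Ext.mk₀_id_comp]
    rfl
  by_contra hne
  rw [not_subsingleton_iff_nontrivial] at hne
  refine Submodule.top_ne_pointwise_smul_of_mem_jacobson_annihilator
    (M := Ext M N n) (IsLocalRing.maximalIdeal_le_jacobson _ hy) ?_
  refine (eq_top_iff.2 fun e _ => ?_).symm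
  obtain ⟨e', rfl⟩ := hsurj e
  exact Submodule.smul_mem_pointwise_smul _ _ _ trivial

/-- If `Ext^{n+1}(-, N)` vanishes on finitely generated modules and `Ext^n(k, N) = 0`, then
`Ext^n(-, N)` vanishes on finitely generated modules. -/
theorem subsingleton_ext_of_residueField {N : ModuleCat.{u} R} [Module.Finite R N] {n : ℕ}
    (h : ∀ M : ModuleCat.{u} R, Module.Finite R M → Subsingleton (Ext M N (n + 1)))
    (hk : Subsingleton (Ext (ModuleCat.of R (R ⧸ IsLocalRing.maximalIdeal R)) N n))
    (M : ModuleCat.{u} R) [hM : Module.Finite R M] : Subsingleton (Ext M N n) := by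
  refine IsNoetherianRing.induction_on_isQuotientEquivQuotientPrime R (M := M) hM
    (motive := fun M _ _ _ => Subsingleton (Ext (ModuleCat.of R M) N n)) ?_ ?_ ?_
  · intro L _ _ _ _
    exact subsingleton_ext_of_isZero (ModuleCat.isZero_of_subsingleton _)
  · intro L _ _ _ p e
    refine subsingleton_ext_of_iso (X := ModuleCat.of R (R ⧸ p.1)) e.symm.toModuleIso ?_
    by_cases hp : p.1 = IsLocalRing.maximalIdeal R
    · rw [hp]
      exact hk
    -- An element of the maximal ideal outside `p` is regular on the domain `R/p`, so Nakayama
    -- descends from degree `n + 1`. Only the residue field needs the hypothesis `hk`.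
    · obtain ⟨y, hy, hyp⟩ := SetLike.exists_of_lt
        (lt_of_le_of_ne (IsLocalRing.le_maximalIdeal p.2.ne_top) hp)
      refine subsingleton_ext_of_quotSMulTop hy ?_ (h _ inferInstance)
      refine (isSMulRegular_quotient_iff_mem_of_smul_mem p.1 y).2 fun r hr => ?_
      exact (p.2.mem_or_mem hr).resolve_left hyp
  · intro L₁ _ _ _ L₂ _ _ _ L₃ _ _ _ f g hf hg hfg h₁ h₃
    exact subsingleton_ext_X₂ (ModuleCat.shortComplex_shortExact
      (ModuleCat.shortComplexOfCompEqZero f g hfg.linearMap_comp_eq_zero) hfg hf hg) h₁ h₃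

theorem exists_ringKrullDim_eq_natCast : ∃ d : ℕ, ringKrullDim R = d := by
  rw [← IsLocalRing.maximalIdeal_height_eq_ringKrullDim]
  obtain ⟨d, hd⟩ := ENat.ne_top_iff_exists.1
    (Ideal.height_ne_top (Ideal.IsPrime.ne_top (I := IsLocalRing.maximalIdeal R) inferInstance))
  exact ⟨d, by rw [← hd]; rfl⟩

theorem length_le_ringKrullDim_of_isRegular {rs : List R}
    (hrs : RingTheory.Sequence.IsRegular R rs) : (rs.length : WithBot ℕ∞) ≤ ringKrullDim R := by
  rw [← ringKrullDim_add_length_eq_ringKrullDim_of_isRegular rs hrs]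
  have : Nontrivial (R ⧸ Ideal.ofList rs) := by
    refine Ideal.Quotient.nontrivial_iff.2 fun h => hrs.top_ne_smul ?_
    rw [h, Submodule.top_smul]
  exact le_add_of_nonneg_left ringKrullDim_nonneg_of_nontrivial

/-- There is a regular sequence such that the residue field embeds into the quotient by it. -/
theorem exists_isRegular_residueField_embedding :
    ∃ rs : List R, (∀ r ∈ rs, r ∈ IsLocalRing.maximalIdeal R) ∧
      RingTheory.Sequence.IsRegular R rs ∧
      ∃ f : (R ⧸ IsLocalRing.maximalIdeal R) →ₗ[R] (R ⧸ Ideal.ofList rs • (⊤ : Submodule R R)),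
        Function.Injective f := by
  let P : ℕ → Prop := fun n => ∃ rs : List R, rs.length = n ∧
    (∀ r ∈ rs, r ∈ IsLocalRing.maximalIdeal R) ∧ RingTheory.Sequence.IsRegular R rs
  obtain ⟨d, hd⟩ := exists_ringKrullDim_eq_natCast (R := R)
  have hbound : ∀ n, P n → n ≤ d := by
    rintro n ⟨rs, rfl, -, hrs⟩
    have := length_le_ringKrullDim_of_isRegular hrs
    rw [hd] at this
    exact_mod_cast this
  have hP0 : P 0 := ⟨[], rfl, by simp, by simp [RingTheory.Sequence.isRegular_iff]⟩
  classical
  obtain ⟨rs, hlen, hmem, hrs⟩ := Nat.findGreatest_spec (P := P) (Nat.zero_le d) hP0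
  refine ⟨rs, hmem, hrs, ?_⟩
  by_contra hno
  have hsub : Subsingleton ((R ⧸ IsLocalRing.maximalIdeal R) →ₗ[R]
      (R ⧸ Ideal.ofList rs • (⊤ : Submodule R R))) := by
    refine subsingleton_of_forall_eq 0 fun f => ?_
    by_contra hf
    have : IsSimpleModule R (R ⧸ IsLocalRing.maximalIdeal R) :=
      isSimpleModule_iff_isCoatom.2 (IsLocalRing.maximalIdeal.isMaximal R).out
    exact hno ⟨f, (LinearMap.injective_or_eq_zero f).resolve_right hf⟩
  -- There is no nonzero map from the simple module `k`, so some `y` in the maximal ideal is regular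
  -- modulo `rs`. Appending it contradicts the maximal length of `rs`.
  obtain ⟨y, hy, hreg⟩ := IsSMulRegular.subsingleton_linearMap_iff.1 hsub
  rw [Ideal.annihilator_quotient] at hy
  have hP : P (rs ++ [y]).length := by
    have hmem' : ∀ r ∈ rs ++ [y], r ∈ IsLocalRing.maximalIdeal R := by
      simpa [or_imp, forall_and] using ⟨hmem, hy⟩
    refine ⟨rs ++ [y], rfl, hmem', .of_isWeaklyRegular_of_mem_maximalIdeal _ hmem' ?_⟩
    rw [RingTheory.Sequence.isWeaklyRegular_append_iff]
    exact ⟨hrs.1, by simpa using hreg⟩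
  have := Nat.le_findGreatest (hbound _ hP) hP
  simp [hlen] at this

/-- If `Ext^n(-, R)` vanishes on finitely generated modules for large `n`, then it does so for
all `n > dim R`. -/
theorem subsingleton_ext_self_of_ringKrullDim_lt {d : ℕ} (hd : ringKrullDim R = d) {N : ℕ}
    (h : ∀ n, N ≤ n → ∀ M : ModuleCat.{u} R, Module.Finite R M →
      Subsingleton (Ext M (ModuleCat.of R R) n))
    {n : ℕ} (hn : d < n) (M : ModuleCat.{u} R) [Module.Finite R M] :
    Subsingleton (Ext M (ModuleCat.of R R) n) := by
  -- Descending induction on the degree: `k` bounds the distance from `n` up to the known range `N`.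
  suffices H : ∀ k n, d < n → N ≤ n + k → ∀ M : ModuleCat.{u} R, Module.Finite R M →
      Subsingleton (Ext M (ModuleCat.of R R) n) from H N n hn (by lia) M inferInstance
  intro k
  induction k with
  | zero => exact fun n _ hN => h n hN
  | succ k ih =>
    intro n hn hN M hM
    have hsucc := ih (n + 1) (by lia) (by lia)
    refine subsingleton_ext_of_residueField hsucc ?_ M
    -- Embed `k` in `R/(rs)`. Its projective dimension is the length of `rs`, at most `d < n`, so
    -- `Ext^n(R/(rs), R) = 0`; the cokernel has no `Ext^{n+1}` by induction. This avoids knowing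
    -- that `R` is Cohen-Macaulay.
    obtain ⟨rs, hmem, hrs, f, hf⟩ := exists_isRegular_residueField_embedding (R := R)
    have hlen : rs.length ≤ d := by
      have := length_le_ringKrullDim_of_isRegular hrs
      rw [hd] at this
      exact_mod_cast this
    have hS := ModuleCat.shortComplex_shortExact
      (ModuleCat.shortComplexOfCompEqZero f (LinearMap.range f).mkQ
        f.exact_map_mkQ_range.linearMap_comp_eq_zero)
      f.exact_map_mkQ_range hf (Submodule.mkQ_surjective _)
    refine subsingleton_ext_X₁ hS ?_ (hsucc _ (inferInstanceAs (Module.Finite R (_ ⧸ _))))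
    have hpd := ModuleCat.projectiveDimension_quotient_eq_add_length_of_isWeaklyRegular
      (ModuleCat.of R R) rs hrs.1 hmem
    rw [show projectiveDimension (ModuleCat.of R R) = 0 from
      ModuleCat.projectiveDimension_eq_zero_of_projective _, zero_add] at hpd
    have hlt := (projectiveDimension_lt_iff (n := n)).1 
      (hpd.trans_lt (by exact_mod_cast hlen.trans_lt hn))
    exact hlt.subsingleton _ n n le_rfl _

/-- Vanishing of `Ext` on modules with long regular sequences. -/
theorem subsingleton_ext_of_isRegular {N : ModuleCat.{u} R} [Module.Finite R N] {i : ℕ}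
    (rs : List R) (hmem : ∀ r ∈ rs, r ∈ IsLocalRing.maximalIdeal R)
    (h : ∀ M : ModuleCat.{u} R, Module.Finite R M → Subsingleton (Ext M N (i + rs.length)))
    (M : ModuleCat.{u} R) [Module.Finite R M] (hrs : RingTheory.Sequence.IsRegular M rs) :
    Subsingleton (Ext M N i) := by
  induction rs generalizing M i with
  | nil => exact h M inferInstance
  | cons y rs ih =>
    rw [RingTheory.Sequence.isRegular_cons_iff] at hrs
    refine subsingleton_ext_of_quotSMulTop (hmem y (by simp)) hrs.1
      (ih (fun r hr => hmem r (by simp [hr])) ?_ _ hrs.2)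
    intro M hM
    have := h M hM
    rwa [List.length_cons, ← add_assoc, add_right_comm] at this

end ExtVanishing

/-! ### Injective dimension modulo a nonzerodivisor -/

section InjectiveDimension

variable {R : Type u} [CommRing R] {x : R}

/-- The map induced on `x`-torsion, as a linear map over `R / x`. -/
def torsionByMap (x : R) {C D : Type u} [AddCommGroup C] [Module R C] [AddCommGroup D] [Module R D]
    (f : C →ₗ[R] D) : Submodule.torsionBy R C x →ₗ[R ⧸ Ideal.span {x}]
      Submodule.torsionBy R D x :=
  LinearMap.extendScalarsOfSurjective Ideal.Quotient.mk_surjective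
    (f.restrict fun c hc => by
      rw [Submodule.mem_torsionBy_iff] at hc ⊢
      rw [← map_smul, hc, map_zero])

/-- The `x`-torsion of an injective `R`-module is an injective `R / x`-module. -/
theorem injective_torsionBy {E : Type u} [AddCommGroup E] [Module R E]
    (hE : Module.Injective R E) :
    Module.Injective (R ⧸ Ideal.span {x}) (Submodule.torsionBy R E x) := by
  refine Module.Baer.injective fun I g => ?_
  have hB := Module.Baer.of_injective hE
  -- Baer's criterion over `R` is applied to the preimage of `I`. The extension `ψ` takes its value
  -- at `1` in the `x`-torsion, since `x` lies in the preimage and maps to zero in `I`.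
  let φ : (I.comap (Ideal.Quotient.mk (Ideal.span {x}))) →ₗ[R] E :=
    { toFun := fun r => (g ⟨Ideal.Quotient.mk _ r.1, r.2⟩ : E)
      map_add' := fun r s => by
        rw [← Submodule.coe_add, ← map_add]; rfl
      map_smul' := fun r s => by
        have := congrArg Subtype.val
          (g.map_smul (Ideal.Quotient.mk _ r) ⟨Ideal.Quotient.mk _ s.1, s.2⟩)
        exact this }
  obtain ⟨ψ, hψ⟩ := hB _ φ
  have hx : x • ψ 1 = 0 := by
    have hxm : x ∈ I.comap (Ideal.Quotient.mk (Ideal.span {x})) := by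
      rw [Ideal.mem_comap, Ideal.Quotient.eq_zero_iff_mem.2 (Ideal.mem_span_singleton_self x)]
      exact I.zero_mem
    rw [← map_smul, smul_eq_mul, mul_one, hψ x hxm]
    have : (⟨Ideal.Quotient.mk (Ideal.span {x}) x, hxm⟩ : I) = 0 := Subtype.ext
      (Ideal.Quotient.eq_zero_iff_mem.2 (Ideal.mem_span_singleton_self x))
    change ((g ⟨Ideal.Quotient.mk (Ideal.span {x}) x, hxm⟩ : Submodule.torsionBy R E x) : E) = 0
    rw [this, map_zero]; rfl
  refine ⟨LinearMap.toSpanSingleton _ _ ⟨ψ 1, (Submodule.mem_torsionBy_iff _ _).2 hx⟩, ?_⟩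
  intro a ha
  obtain ⟨r, rfl⟩ := Ideal.Quotient.mk_surjective a
  refine Subtype.ext ?_
  have h₁ : ψ r = r • ψ 1 := by rw [← map_smul, smul_eq_mul, mul_one]
  exact h₁.symm.trans (hψ r ha)

theorem torsionByMap_injective {C D : Type u} [AddCommGroup C] [Module R C] [AddCommGroup D]
    [Module R D] {f : C →ₗ[R] D} (hf : Function.Injective f) :
    Function.Injective (torsionByMap x f) := fun _ _ h =>
  Subtype.ext (hf (congrArg Subtype.val h))

theorem torsionByMap_exact {C D E : Type u} [AddCommGroup C] [Module R C] [AddCommGroup D]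
    [Module R D] [AddCommGroup E] [Module R E] {f : C →ₗ[R] D} {g : D →ₗ[R] E}
    (hf : Function.Injective f) (hfg : Function.Exact f g) :
    Function.Exact (torsionByMap x f) (torsionByMap x g) := by
  intro d
  constructor
  · intro h
    obtain ⟨c, hc⟩ := (hfg d.1).1 (congrArg Subtype.val h)
    refine ⟨⟨c, (Submodule.mem_torsionBy_iff _ _).2 (hf ?_)⟩, Subtype.ext hc⟩
    rw [map_smul, hc, map_zero]
    exact (Submodule.mem_torsionBy_iff _ _).1 d.2
  · rintro ⟨c, rfl⟩
    exact Subtype.ext ((hfg _).2 ⟨c.1, rfl⟩)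

/-- The obstruction to lifting torsion lies in `C/xC`, which is zero for divisible `C`. -/
theorem torsionByMap_surjective {C D E : Type u} [AddCommGroup C] [Module R C] [AddCommGroup D]
    [Module R D] [AddCommGroup E] [Module R E] {f : C →ₗ[R] D} {g : D →ₗ[R] E}
    (hfg : Function.Exact f g) (hg : Function.Surjective g)
    (hdiv : ∀ c : C, ∃ c' : C, x • c' = c) :
    Function.Surjective (torsionByMap x g) := by
  rintro ⟨e, he⟩
  obtain ⟨d, rfl⟩ := hg e
  rw [Submodule.mem_torsionBy_iff, ← map_smul] at he
  obtain ⟨c, hc⟩ := (hfg _).1 he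
  obtain ⟨c, rfl⟩ := hdiv c
  refine ⟨⟨d - f c, ?_⟩, Subtype.ext ?_⟩
  · rw [Submodule.mem_torsionBy_iff, smul_sub, ← map_smul, hc, sub_self]
  · change g (d - f c) = g d
    rw [map_sub, (hfg _).2 ⟨c, rfl⟩, sub_zero]

/-- Injective modules are divisible by nonzerodivisors. -/
theorem Module.Injective.exists_smul_eq {E : Type u} [AddCommGroup E] [Module R E]
    (hE : Module.Injective R E) (hx : x ∈ nonZeroDivisors R) (e : E) : ∃ e' : E, x • e' = e := by
  obtain ⟨h, hh⟩ := hE.out (LinearMap.lsmul R R x)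
    (fun a b hab => (mul_cancel_left_mem_nonZeroDivisors hx).1 hab)
    (LinearMap.toSpanSingleton R E e)
  refine ⟨h 1, ?_⟩
  have := hh 1
  rw [LinearMap.toSpanSingleton_apply, one_smul] at this
  rw [← this, ← map_smul]
  rfl

/-- An `x`-divisible `R`-module of finite injective dimension has `x`-torsion of finite injective
dimension over `R / x`. -/
theorem hasInjectiveDimensionLT_torsionBy (hx : x ∈ nonZeroDivisors R) {n : ℕ} {C : Type u}
    [AddCommGroup C] [Module R C] (hdiv : ∀ c : C, ∃ c' : C, x • c' = c)
    (hC : HasInjectiveDimensionLT (ModuleCat.of R C) (n + 1)) :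
    HasInjectiveDimensionLT (ModuleCat.of (R ⧸ Ideal.span {x}) (Submodule.torsionBy R C x))
      (n + 1) := by
  induction n generalizing C with
  | zero =>
    rw [zero_add, ← injective_iff_hasInjectiveDimensionLT_one,
      ← Module.injective_iff_injective_object] at hC ⊢
    exact injective_torsionBy hC
  | succ n ih =>
    obtain ⟨E, hE, f, hf⟩ := EnoughInjectives.presentation (ModuleCat.of R C)
    have hf' : Function.Injective f.hom := (ModuleCat.mono_iff_injective f).1 hf
    have hE' : Module.Injective R E := (Module.injective_iff_injective_object R E).2 hE
    have hS := ModuleCat.shortComplex_shortExact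
      (ModuleCat.shortComplexOfCompEqZero f.hom (LinearMap.range f.hom).mkQ
        f.hom.exact_map_mkQ_range.linearMap_comp_eq_zero)
      f.hom.exact_map_mkQ_range hf' (Submodule.mkQ_surjective _)
    have hX := (hS.hasInjectiveDimensionLT_X₃_iff n hE).2 hC
    -- Dimension shift: the cokernel is again divisible, being a quotient of the injective module
    -- `E`.
    have hX' := ih (C := E ⧸ LinearMap.range f.hom) (fun d => by
      obtain ⟨e, rfl⟩ := Submodule.mkQ_surjective _ d
      obtain ⟨e', rfl⟩ := hE'.exists_smul_eq hx e
      exact ⟨Submodule.mkQ _ e', (map_smul _ _ _).symm⟩) hX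
    have hexact := torsionByMap_exact (x := x) hf' f.hom.exact_map_mkQ_range
    have hS' := ModuleCat.shortComplex_shortExact
      (ModuleCat.shortComplexOfCompEqZero (torsionByMap x f.hom)
        (torsionByMap x (LinearMap.range f.hom).mkQ) hexact.linearMap_comp_eq_zero) hexact
      (torsionByMap_injective hf')
      (torsionByMap_surjective f.hom.exact_map_mkQ_range (Submodule.mkQ_surjective _) hdiv)
    have := (Module.injective_iff_injective_object _ _).1 (injective_torsionBy (x := x) hE')
    exact (hS'.hasInjectiveDimensionLT_X₃_iff n this).1 hX'

/-- If `0 → R → E → D → 0` is exact and `x` divides the image of `1` in `E`, then `R / x` is a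
retract of the `x`-torsion of `D`. -/
theorem exists_retraction_torsionBy {E D : Type u} [AddCommGroup E] [Module R E] [AddCommGroup D]
    [Module R D] {f : R →ₗ[R] E} {g : E →ₗ[R] D} (hf : Function.Injective f)
    (hfg : Function.Exact f g) (hg : Function.Surjective g) {e₀ : E} (he₀ : x • e₀ = f 1) :
    ∃ (s : (R ⧸ Ideal.span {x}) →ₗ[R ⧸ Ideal.span {x}] Submodule.torsionBy R D x)
      (ρ : Submodule.torsionBy R D x →ₗ[R ⧸ Ideal.span {x}] (R ⧸ Ideal.span {x})),
      ρ ∘ₗ s = LinearMap.id := by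
  have hfr : ∀ r : R, f r = x • r • e₀ := fun r => by
    rw [smul_comm, he₀, ← map_smul, smul_eq_mul, mul_one]
  let s : (R ⧸ Ideal.span {x}) →ₗ[R ⧸ Ideal.span {x}] Submodule.torsionBy R D x :=
    LinearMap.toSpanSingleton _ _ ⟨g e₀, (Submodule.mem_torsionBy_iff _ _).2 (by
      rw [← map_smul, he₀]
      exact (hfg _).2 ⟨1, rfl⟩)⟩
  have hs : ∀ r : R, (s (Ideal.Quotient.mk _ r) : D) = g (r • e₀) := fun r =>
    (map_smul _ _ _).symm
  -- The snake lemma gives `0 → E[x] → D[x] → R/x → 0`. The class of `e₀` splits it, so `φ` is an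
  -- isomorphism from `E[x] × R/x` onto `D[x]`.
  let φ := (torsionByMap x g).coprod s
  have hφ : ∀ (e : Submodule.torsionBy R E x) (r : R),
      (φ (e, Ideal.Quotient.mk _ r) : D) = g (e.1 + r • e₀) := fun e r => by
    rw [map_add, ← hs]; rfl
  have hinj : Function.Injective φ := by
    rw [injective_iff_map_eq_zero]
    rintro ⟨e, r⟩ h
    obtain ⟨r, rfl⟩ := Ideal.Quotient.mk_surjective r
    have h' := hφ e r
    rw [h] at h'
    obtain ⟨t, ht⟩ := (hfg _).1 h'.symm
    have he := (Submodule.mem_torsionBy_iff _ _).1 e.2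
    have hrt : r = x * t := hf (by
      rw [← smul_eq_mul x, map_smul, ht, smul_add, he, zero_add, hfr])
    have h₀ : e.1 = 0 := by
      rw [hfr, hrt, mul_smul] at ht
      exact right_eq_add.1 ht
    exact Prod.ext (Subtype.ext h₀)
      (Ideal.Quotient.eq_zero_iff_mem.2 (Ideal.mem_span_singleton.2 ⟨t, hrt⟩))
  have hsurj : Function.Surjective φ := by
    rintro ⟨d, hd⟩
    obtain ⟨e, rfl⟩ := hg d
    rw [Submodule.mem_torsionBy_iff, ← map_smul] at hd
    obtain ⟨r, hr⟩ := (hfg _).1 hd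
    refine ⟨(⟨e - r • e₀, ?_⟩, Ideal.Quotient.mk _ r), Subtype.ext ?_⟩
    · rw [Submodule.mem_torsionBy_iff, smul_sub, ← hfr, hr, sub_self]
    · rw [hφ, sub_add_cancel]
  let ψ := LinearEquiv.ofBijective φ ⟨hinj, hsurj⟩
  refine ⟨s, LinearMap.snd _ _ _ ∘ₗ ψ.symm.toLinearMap, LinearMap.ext fun r => ?_⟩
  have : s r = ψ (0, r) := by
    change s r = φ (0, r)
    rw [LinearMap.coprod_apply, map_zero, zero_add]
  change (ψ.symm (s r)).2 = r
  rw [this, ψ.symm_apply_apply]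

/-- A Gorenstein local ring modulo a nonzerodivisor in the maximal ideal is Gorenstein. -/
theorem IsGorensteinLocalRing.quotient_span_singleton [IsGorensteinLocalRing R]
    [Nontrivial (R ⧸ Ideal.span {x})] (hx : x ∈ nonZeroDivisors R) :
    IsGorensteinLocalRing (R ⧸ Ideal.span {x}) := by
  obtain ⟨n, hn⟩ := IsGorensteinLocalRing.exists_hasInjectiveDimensionLE (R := R)
  -- The bound is weakened by one so that the cokernel still has a bound of the form `n + 1` when `n
  -- = 0`.
  have hR : HasInjectiveDimensionLT (ModuleCat.of R R) (n + 2) :=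
    hasInjectiveDimensionLT_of_ge _ (n + 1) _ (by lia)
  obtain ⟨E, hE, f, hf⟩ := EnoughInjectives.presentation (ModuleCat.of R R)
  have hf' : Function.Injective f.hom := (ModuleCat.mono_iff_injective f).1 hf
  have hE' : Module.Injective R E := (Module.injective_iff_injective_object R E).2 hE
  have hS := ModuleCat.shortComplex_shortExact
    (ModuleCat.shortComplexOfCompEqZero f.hom (LinearMap.range f.hom).mkQ
      f.hom.exact_map_mkQ_range.linearMap_comp_eq_zero)
    f.hom.exact_map_mkQ_range hf' (Submodule.mkQ_surjective _)
  have hD := hasInjectiveDimensionLT_torsionBy (C := E ⧸ LinearMap.range f.hom) hx (fun d => by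
    obtain ⟨e, rfl⟩ := Submodule.mkQ_surjective _ d
    obtain ⟨e', rfl⟩ := hE'.exists_smul_eq hx e
    exact ⟨Submodule.mkQ _ e', (map_smul _ _ _).symm⟩)
    ((hS.hasInjectiveDimensionLT_X₃_iff n hE).2 hR)
  obtain ⟨e₀, he₀⟩ := hE'.exists_smul_eq hx (f.hom (1 : R))
  obtain ⟨s, ρ, hρ⟩ := exists_retraction_torsionBy hf' f.hom.exact_map_mkQ_range
    (Submodule.mkQ_surjective _) he₀
  have hret : Retract (ModuleCat.of (R ⧸ Ideal.span {x}) (R ⧸ Ideal.span {x}))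
      (ModuleCat.of (R ⧸ Ideal.span {x})
        (Submodule.torsionBy R (E ⧸ LinearMap.range f.hom) x)) :=
    { i := ModuleCat.ofHom s
      r := ModuleCat.ofHom ρ
      retract := by rw [← ModuleCat.ofHom_comp, hρ]; rfl }
  exact { exists_hasInjectiveDimensionLE := ⟨n, hret.hasInjectiveDimensionLT _⟩ }

end InjectiveDimension

/-! ### Maximal Cohen-Macaulay modules modulo a nonzerodivisor -/

section MaximalCohenMacaulay

open scoped Pointwise

variable {R : Type u} [CommRing R] [IsLocalRing R] [IsNoetherianRing R]

/-- An associated prime of `M` lies strictly below an associated prime of `M / yM`. -/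
theorem exists_lt_isAssociatedPrime_quotSMulTop {M : Type u} [AddCommGroup M] [Module R M]
    [Module.Finite R M] {y : R} (hy : y ∈ IsLocalRing.maximalIdeal R) (hreg : IsSMulRegular M y)
    {p : Ideal R} (hp : IsAssociatedPrime p M) :
    ∃ q : Ideal R, IsAssociatedPrime q (QuotSMulTop y M) ∧ p < q := by
  obtain ⟨hprime, m, hm⟩ := isAssociatedPrime_iff.1 hp
  have hpm : ∀ r, r ∈ p ↔ r • m = 0 := fun r => by
    rw [hm, Submodule.mem_colon_singleton, Submodule.mem_bot]
  let N : Submodule R M := Submodule.torsionBySet R M p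
  have hmN : m ∈ N := (Submodule.mem_torsionBySet_iff _ _).2 fun r => (hpm r).1 r.2
  have hm₀ : m ≠ 0 := fun h => hprime.ne_top ((Ideal.eq_top_iff_one p).2 ((hpm 1).2 (by simp [h])))
  -- If the elements killed by `p` all lay in `yM`, regularity of `y` would give `N = yN`, and
  -- Nakayama would force `N = 0`. The class of `n` in `M/yM` is then nonzero and killed by both `p`
  -- and `y`.
  obtain ⟨n, hnN, hn⟩ : ∃ n ∈ N, n ∉ y • (⊤ : Submodule R M) := by
    by_contra! hle
    have hN : N = ⊥ := by
      refine Submodule.eq_bot_of_le_smul_of_le_jacobson_bot (Ideal.span {y}) N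
        (IsNoetherian.noetherian N) ?_ ?_
      · intro n hn
        obtain ⟨n', -, rfl⟩ := (Submodule.mem_smul_pointwise_iff_exists _ _ _).1 (hle n hn)
        refine Submodule.smul_mem_smul (Ideal.mem_span_singleton_self y) ?_
        rw [Submodule.mem_torsionBySet_iff] at hn ⊢
        intro r
        refine hreg.right_eq_zero_of_smul ?_
        rw [smul_comm]
        exact hn r
      · rw [Ideal.span_singleton_le_iff_mem, IsLocalRing.jacobson_eq_maximalIdeal _ bot_ne_top]
        exact hy
    rw [hN] at hmN
    exact hm₀ hmN
  obtain ⟨q, hq, hle⟩ := exists_le_isAssociatedPrime_of_isNoetherianRing R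
    (Submodule.Quotient.mk n : QuotSMulTop y M) (by rwa [ne_eq, Submodule.Quotient.mk_eq_zero])
  have hyq : y ∈ q := hle (by
    rw [Submodule.mem_colon_singleton, Submodule.mem_bot, ← Submodule.Quotient.mk_smul,
      Submodule.Quotient.mk_eq_zero]
    exact Submodule.smul_mem_pointwise_smul _ _ _ trivial)
  refine ⟨q, hq, lt_of_le_not_ge (fun r hr => hle ?_) fun h => hm₀ ?_⟩
  · rw [Submodule.mem_colon_singleton, Submodule.mem_bot, ← Submodule.Quotient.mk_smul,
      (Submodule.mem_torsionBySet_iff _ _).1 hnN ⟨r, hr⟩, Submodule.Quotient.mk_zero]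
  · exact hreg.right_eq_zero_of_smul ((hpm y).1 (h hyq))

/-- Each element of the sequence forces a strict step up between associated primes of successive
quotients. -/
theorem length_le_coheight_of_isAssociatedPrime (rs : List R)
    (hmem : ∀ r ∈ rs, r ∈ IsLocalRing.maximalIdeal R) {M : Type u} [AddCommGroup M] [Module R M]
    [Module.Finite R M] (hrs : RingTheory.Sequence.IsRegular M rs) {p : Ideal R}
    (hp : IsAssociatedPrime p M) :
    (rs.length : ℕ∞) ≤ Order.coheight (⟨p, hp.isPrime⟩ : PrimeSpectrum R) := by
  induction rs generalizing M p with
  | nil => simp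
  | cons y rs ih =>
    rw [RingTheory.Sequence.isRegular_cons_iff] at hrs
    obtain ⟨q, hq, hlt⟩ := exists_lt_isAssociatedPrime_quotSMulTop (hmem y (by simp)) hrs.1 hp
    have h := ih (fun r hr => hmem r (by simp [hr])) hrs.2 hq
    have hlt' : (⟨p, hp.isPrime⟩ : PrimeSpectrum R) < ⟨q, hq.isPrime⟩ := hlt
    rw [List.length_cons, Nat.cast_add, Nat.cast_one]
    exact (add_le_add_left h 1).trans (Order.coheight_add_one_le hlt')

theorem IsMaximalCohenMacaulay.exists_isRegular {M : Type u} [AddCommGroup M] [Module R M]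
    [Nontrivial M] (hM : IsMaximalCohenMacaulay R M) :
    ∃ rs : List R, (∀ r ∈ rs, r ∈ IsLocalRing.maximalIdeal R) ∧
      RingTheory.Sequence.IsRegular M rs ∧ ringKrullDim R ≤ (rs.length : WithBot ℕ∞) := by
  obtain ⟨d, hd⟩ := exists_ringKrullDim_eq_natCast (R := R)
  have hdim := hM.dim_le_depth
  rw [hd, moduleDepth, if_neg (not_subsingleton M)] at hdim
  have hdim' := WithBot.coe_le_coe.1 hdim
  by_contra! hlt
  -- Dimension zero is met by the empty sequence. Otherwise, lengths all below `d + 1` would bound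
  -- the supremum by `d`.
  obtain _ | d := d
  · have := hlt [] (by simp) (by simp [RingTheory.Sequence.isRegular_iff])
    rw [hd] at this
    simp at this
  · have hle : (((d + 1 : ℕ) : ℕ∞)) ≤ (d : ℕ∞) := hdim'.trans <| iSup₂_le fun rs h => by
      have := hlt rs h.1 h.2
      rw [hd] at this
      have : rs.length < d + 1 := by exact_mod_cast this
      exact_mod_cast Nat.lt_succ_iff.1 this
    have : d + 1 ≤ d := by exact_mod_cast hle
    lia

/-- A nonzerodivisor of the ring is regular on every maximal Cohen-Macaulay module. -/
theorem IsMaximalCohenMacaulay.isSMulRegular {M : Type u} [AddCommGroup M] [Module R M]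
    (hM : IsMaximalCohenMacaulay R M) {x : R} (hx : x ∈ nonZeroDivisors R) :
    IsSMulRegular M x := by
  have := hM.finite
  obtain _ | _ := subsingleton_or_nontrivial M
  · exact fun _ _ _ => Subsingleton.elim _ _
  obtain ⟨rs, hmem, hrs, hdim⟩ := hM.exists_isRegular
  by_contra hreg
  have hmemU : x ∈ ⋃ p ∈ associatedPrimes R M, (p : Set R) := by
    rw [biUnion_associatedPrimes_eq_compl_regular]
    exact hreg
  simp only [Set.mem_iUnion] at hmemU
  obtain ⟨p, hp, hxp⟩ := hmemU
  have hpp : p.IsPrime := IsAssociatedPrime.isPrime hp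
  have hco := length_le_coheight_of_isAssociatedPrime rs hmem hrs hp
  -- A minimal prime avoids the nonzerodivisor `x`, so it lies strictly below `p`. Its coheight
  -- would then exceed the dimension.
  obtain ⟨q, hq, hqp⟩ := Ideal.exists_minimalPrimes_le (bot_le : ⊥ ≤ p)
  have hxq : x ∉ q := by
    have hR : IsSMulRegular R x := Module.Flat.isSMulRegular_of_nonZeroDivisors hx
    refine hR.notMem_of_mem_minimalPrimes ?_
    rwa [Module.annihilator_eq_bot.2 inferInstance]
  have hlt : (⟨q, hq.1.1⟩ : PrimeSpectrum R) < ⟨p, hpp⟩ :=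
    lt_of_le_of_ne hqp fun h => hxq (by
      have : q = p := congrArg PrimeSpectrum.asIdeal h
      rwa [this])
  have h₁ := (add_le_add_left hco 1).trans (Order.coheight_add_one_le hlt)
  have h₂ : ((rs.length + 1 : ℕ∞) : WithBot ℕ∞) ≤ (rs.length : WithBot ℕ∞) :=
    (WithBot.coe_le_coe.2 h₁).trans ((Order.coheight_le_krullDim _).trans hdim)
  have : rs.length + 1 ≤ rs.length := by exact_mod_cast h₂
  lia

/-- Dividing by a regular element of the maximal ideal shortens regular sequences by at most one. -/
theorem exists_isRegular_quotSMulTop {M : Type u} [AddCommGroup M] [Module R M]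
    [Module.Finite R M] [Nontrivial M] {x : R} (hx : x ∈ IsLocalRing.maximalIdeal R)
    (hreg : IsSMulRegular M x) {n : ℕ} (rs : List R)
    (hmem : ∀ r ∈ rs, r ∈ IsLocalRing.maximalIdeal R)
    (hrs : RingTheory.Sequence.IsRegular M rs) (hn : n < rs.length) :
    ∃ rs' : List R, rs'.length = n ∧ (∀ r ∈ rs', r ∈ IsLocalRing.maximalIdeal R) ∧
      RingTheory.Sequence.IsRegular (QuotSMulTop x M) rs' := by
  let k := ModuleCat.of R (R ⧸ IsLocalRing.maximalIdeal R)
  have hsupp : Module.support R k = PrimeSpectrum.zeroLocus (IsLocalRing.maximalIdeal R) := by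
    rw [Module.support_eq_zeroLocus, Ideal.annihilator_quotient]
  have hlt : ∀ (L : Type u) [AddCommGroup L] [Module R L] [Module.Finite R L] [Nontrivial L],
      IsLocalRing.maximalIdeal R • (⊤ : Submodule R L) < ⊤ := fun L _ _ _ _ =>
    (Submodule.top_ne_ideal_smul_of_le_jacobson_annihilator
      (IsLocalRing.maximalIdeal_le_jacobson _)).symm.lt_top
  have : Nontrivial (QuotSMulTop x M) := nontrivial_quotSMulTop_of_mem_maximalIdeal M hx
  -- Depth is measured by `Ext^i(k, -)`. Vanishing for `M` in degrees `i` and `i + 1` gives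
  -- vanishing for `M/xM` in degree `i`.
  have hM := ModuleCat.subsingleton_ext_of_exists_isRegular (IsLocalRing.maximalIdeal R) k
    hsupp.subset (ModuleCat.of R M) (hlt M) rs hmem hrs
  refine ModuleCat.exists_isRegular_of_exists_subsingleton_ext _ n
    (ModuleCat.of R (QuotSMulTop x M)) (hlt _) k hsupp fun i hi => ?_
  refine subsingleton_of_forall_eq 0 fun e => ?_
  obtain ⟨e', rfl⟩ := Abelian.Ext.covariant_sequence_exact₃ k
    (IsSMulRegular.smulShortComplex_shortExact (M := ModuleCat.of R M) hreg) e rfl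
    (ext_eq_zero_of_subsingleton (hM (i + 1) (by lia)) _)
  have he' : e' = 0 := ext_eq_zero_of_subsingleton (hM i (by lia)) e'
  rw [he', Abelian.Ext.zero_comp]
  rfl

theorem IsMaximalCohenMacaulay.quotSMulTop {M : Type u} [AddCommGroup M] [Module R M]
    (hM : IsMaximalCohenMacaulay R M) {x : R} [Nontrivial (R ⧸ Ideal.span {x})]
    (hx : x ∈ nonZeroDivisors R) :
    IsMaximalCohenMacaulay (R ⧸ Ideal.span {x}) (QuotSMulTop x M) := by
  have := hM.finite
  have hfin : Module.Finite (R ⧸ Ideal.span {x}) (QuotSMulTop x M) :=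
    Module.Finite.of_restrictScalars_finite R _ _
  refine ⟨hfin, ?_⟩
  obtain _ | _ := subsingleton_or_nontrivial M
  · rw [moduleDepth, if_pos (inferInstanceAs (Subsingleton (QuotSMulTop x M)))]
    exact le_top
  have hxm : x ∈ IsLocalRing.maximalIdeal R := by
    rw [IsLocalRing.mem_maximalIdeal, mem_nonunits_iff, ← Ideal.span_singleton_eq_top]
    exact Ideal.Quotient.nontrivial_iff.1 ‹_›
  have hreg := hM.isSMulRegular hx
  have : Nontrivial (QuotSMulTop x M) := nontrivial_quotSMulTop_of_mem_maximalIdeal M hxm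
  rw [moduleDepth, if_neg (not_subsingleton _)]
  obtain ⟨rs, hmem, hrs, hdim⟩ := hM.exists_isRegular
  have hdim' := ringKrullDim_quotient_span_singleton_succ_eq_ringKrullDim_of_mem_nonZeroDivisors
    hx hxm
  obtain ⟨d, hd⟩ := exists_ringKrullDim_eq_natCast (R := R ⧸ Ideal.span {x})
  rw [← hdim', hd] at hdim
  have hlen : d < rs.length := by exact_mod_cast hdim
  obtain ⟨rs', hlen', hmem', hrs'⟩ := exists_isRegular_quotSMulTop hxm hreg rs hmem hrs hlen
  rw [hd, ← hlen', ← List.length_map (Ideal.Quotient.mk (Ideal.span {x}))]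
  have hmax : (IsLocalRing.maximalIdeal (R ⧸ Ideal.span {x})).comap
      (Ideal.Quotient.mk (Ideal.span {x})) = IsLocalRing.maximalIdeal R :=
    IsLocalRing.eq_maximalIdeal
      (Ideal.comap_isMaximal_of_surjective _ Ideal.Quotient.mk_surjective)
  refine WithBot.coe_le_coe.2 (le_iSup₂_of_le _ ⟨?_, ?_⟩ le_rfl)
  · intro r hr
    obtain ⟨s, hs, rfl⟩ := List.mem_map.1 hr
    exact (hmax.symm ▸ hmem' s hs : s ∈ Ideal.comap _ _)
  -- Both criteria for `x :: rs'` on `M` are compared: one reads the tail over `R`, the other its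
  -- image over `R/x`.
  · exact ((RingTheory.Sequence.isRegular_cons_iff' M x rs').1
      ((RingTheory.Sequence.isRegular_cons_iff M x rs').2 ⟨hreg, hrs'⟩)).2

end MaximalCohenMacaulay

/-! ### Stable annihilators modulo a nonzerodivisor -/

section Stable

open scoped Pointwise

variable {R : Type u} [CommRing R]

theorem mem_stableAnnihilator_iff {M : Type u} [AddCommGroup M] [Module R M] {r : R} :
    r ∈ stableAnnihilator R M ↔ r • LinearMap.id ∈ projectiveHom R M M := by
  rw [stableAnnihilator, Module.mem_annihilator]
  constructor
  · intro h
    have := h (Submodule.Quotient.mk LinearMap.id)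
    rwa [← Submodule.Quotient.mk_smul, Submodule.Quotient.mk_eq_zero] at this
  · rintro h f
    obtain ⟨f, rfl⟩ := Submodule.Quotient.mk_surjective _ f
    rw [← Submodule.Quotient.mk_smul, Submodule.Quotient.mk_eq_zero]
    have := comp_mem_projectiveHom_of_left h f
    rwa [LinearMap.smul_comp, LinearMap.id_comp] at this

/-- A homomorphism in `P(M, N)` factors through a finite free module. -/
theorem exists_factor_pi_of_mem_projectiveHom {M N : Type u} [AddCommGroup M] [Module R M]
    [AddCommGroup N] [Module R N] {f : M →ₗ[R] N} (hf : f ∈ projectiveHom R M N) :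
    ∃ (n : ℕ) (a : M →ₗ[R] Fin n → R) (b : (Fin n → R) →ₗ[R] N), f = b ∘ₗ a := by
  obtain ⟨P, _, _, _, _, a, b, rfl⟩ := hf
  obtain ⟨n, p, hp⟩ := Module.Finite.exists_fin' R P
  obtain ⟨s, hs⟩ := Module.projective_lifting_property p LinearMap.id hp
  refine ⟨n, s ∘ₗ a, b ∘ₗ p, ?_⟩
  exact LinearMap.ext fun m => congrArg b (LinearMap.congr_fun hs (a m)).symm

/-- Reduction of a linear map modulo `x`, as a linear map over `R / x`. -/
def quotSMulTopMap (x : R) {M N : Type u} [AddCommGroup M] [Module R M] [AddCommGroup N]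
    [Module R N] (f : M →ₗ[R] N) : QuotSMulTop x M →ₗ[R ⧸ Ideal.span {x}] QuotSMulTop x N :=
  (QuotSMulTop.map x f).extendScalarsOfSurjective Ideal.Quotient.mk_surjective

theorem quotSMulTopMap_comp (x : R) {L M N : Type u} [AddCommGroup L] [Module R L]
    [AddCommGroup M] [Module R M] [AddCommGroup N] [Module R N] (g : M →ₗ[R] N) (f : L →ₗ[R] M) :
    quotSMulTopMap x (g ∘ₗ f) = quotSMulTopMap x g ∘ₗ quotSMulTopMap x f :=
  LinearMap.ext fun m => Submodule.Quotient.induction_on _ m fun _ => rfl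

theorem quotSMulTopMap_id (x : R) (M : Type u) [AddCommGroup M] [Module R M] :
    quotSMulTopMap x (LinearMap.id : M →ₗ[R] M) = LinearMap.id :=
  LinearMap.ext fun m => Submodule.Quotient.induction_on _ m fun _ => rfl

theorem quotSMulTopMap_sub (x : R) {M N : Type u} [AddCommGroup M] [Module R M] [AddCommGroup N]
    [Module R N] (f g : M →ₗ[R] N) :
    quotSMulTopMap x (f - g) = quotSMulTopMap x f - quotSMulTopMap x g :=
  LinearMap.ext fun m => Submodule.Quotient.induction_on _ m fun _ => rfl

theorem quotSMulTopMap_mem_projectiveHom (x : R) {M N : Type u} [AddCommGroup M] [Module R M]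
    [AddCommGroup N] [Module R N] {f : M →ₗ[R] N} (hf : f ∈ projectiveHom R M N) :
    quotSMulTopMap x f ∈ projectiveHom (R ⧸ Ideal.span {x}) (QuotSMulTop x M)
      (QuotSMulTop x N) := by
  obtain ⟨P, _, _, _, _, a, b, rfl⟩ := hf
  refine ⟨QuotSMulTop x P, inferInstance, inferInstance,
    Module.Finite.of_restrictScalars_finite R _ _, ?_, quotSMulTopMap x a, quotSMulTopMap x b,
    quotSMulTopMap_comp x b a⟩
  exact Module.Projective.of_equiv ((QuotSMulTop.equivQuotTensor x P).extendScalarsOfSurjective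
    Ideal.Quotient.mk_surjective).symm

theorem mk_mem_stableAnnihilator_quotSMulTop (x : R) {M : Type u} [AddCommGroup M] [Module R M]
    {r : R} (hr : r ∈ stableAnnihilator R M) :
    Ideal.Quotient.mk (Ideal.span {x}) r ∈
      stableAnnihilator (R ⧸ Ideal.span {x}) (QuotSMulTop x M) := by
  rw [mem_stableAnnihilator_iff] at hr ⊢
  have := quotSMulTopMap_mem_projectiveHom x hr
  have h : Ideal.Quotient.mk (Ideal.span {x}) r • LinearMap.id =
      quotSMulTopMap x (r • LinearMap.id : M →ₗ[R] M) :=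
    LinearMap.ext fun m => Submodule.Quotient.induction_on _ m fun _ => rfl
  rwa [h]

/-- If `Ext^1(M, R) = 0`, linear forms modulo a regular element lift. -/
theorem exists_lift_of_subsingleton_ext_one {M : Type u} [AddCommGroup M] [Module R M]
    (hM : Subsingleton (Abelian.Ext (ModuleCat.of R M) (ModuleCat.of R R) 1)) {x : R}
    (hx : x ∈ nonZeroDivisors R) (φ : M →ₗ[R] R ⧸ Ideal.span {x}) :
    ∃ ψ : M →ₗ[R] R, ∀ m, Ideal.Quotient.mk _ (ψ m) = φ m := by
  have hex : Function.Exact (LinearMap.lsmul R R x) (Ideal.span {x}).mkQ := by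
    intro r
    rw [Submodule.mkQ_apply, Submodule.Quotient.mk_eq_zero, Ideal.mem_span_singleton']
    simp [mul_comm]
  have hS := ModuleCat.shortComplex_shortExact
    (ModuleCat.shortComplexOfCompEqZero (LinearMap.lsmul R R x) (Ideal.span {x}).mkQ
      hex.linearMap_comp_eq_zero) hex
    (fun a b hab => (mul_cancel_left_mem_nonZeroDivisors hx).1 hab) (Submodule.mkQ_surjective _)
  obtain ⟨e, he⟩ := Abelian.Ext.covariant_sequence_exact₃ (ModuleCat.of R M) hS
    (Abelian.Ext.mk₀ (ModuleCat.ofHom φ)) (zero_add 1) (ext_eq_zero_of_subsingleton hM _)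
  obtain ⟨ψ, rfl⟩ := (Abelian.Ext.mk₀_bijective _ _).2 e
  rw [Abelian.Ext.mk₀_comp_mk₀] at he
  have h := (Abelian.Ext.mk₀_bijective _ _).1 he
  exact ⟨ψ.hom, fun m => congrArg (fun f : ModuleCat.of R M ⟶ _ => f.hom m) h⟩

/-- A factorization modulo `x` lifts up to an error divisible by `x`, and that error is stably
trivial because `x` annihilates `M` stably. -/
theorem mem_stableAnnihilator_of_mk_mem {M : Type u} [AddCommGroup M] [Module R M]
    (hM : Subsingleton (Abelian.Ext (ModuleCat.of R M) (ModuleCat.of R R) 1)) {x : R}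
    (hx : x ∈ nonZeroDivisors R) (hreg : IsSMulRegular M x) (hxM : x ∈ stableAnnihilator R M)
    {r : R} (hr : Ideal.Quotient.mk (Ideal.span {x}) r ∈
      stableAnnihilator (R ⧸ Ideal.span {x}) (QuotSMulTop x M)) :
    r ∈ stableAnnihilator R M := by
  rw [mem_stableAnnihilator_iff] at hr hxM ⊢
  obtain ⟨n, a, b, hab⟩ := exists_factor_pi_of_mem_projectiveHom hr
  let q : M →ₗ[R] QuotSMulTop x M := Submodule.mkQ _
  let α : M →ₗ[R] Fin n → R ⧸ Ideal.span {x} := a.restrictScalars R ∘ₗ q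
  -- The vanishing of `Ext¹` is used here, one coordinate of `a` at a time.
  choose ψ hψ using fun i => exists_lift_of_subsingleton_ext_one hM hx (LinearMap.proj i ∘ₗ α)
  choose c hc using fun i => Submodule.mkQ_surjective (x • (⊤ : Submodule R M)) (b (Pi.single i 1))
  let A : M →ₗ[R] Fin n → R := LinearMap.pi ψ
  let B : (Fin n → R) →ₗ[R] M := Fintype.linearCombination R c
  have hB : ∀ v : Fin n → R, q (B v) = b fun i => Ideal.Quotient.mk _ (v i) := by
    intro v
    have hv : (fun i => Ideal.Quotient.mk (Ideal.span {x}) (v i)) =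
        ∑ i, v i • Pi.single (M := fun _ => R ⧸ Ideal.span {x}) i 1 := by
      ext j
      simp [Finset.sum_apply, Pi.single_apply, Algebra.smul_def]
    have hb : ∀ (s : R) w, b (s • w) = s • b w := (b.restrictScalars R).map_smul
    rw [hv, map_sum, Fintype.linearCombination_apply, map_sum]
    exact Finset.sum_congr rfl fun i _ => by rw [hb, map_smul]; exact congrArg _ (hc i)
  have hmem : ∀ m, (r • LinearMap.id - B ∘ₗ A : M →ₗ[R] M) m ∈ x • (⊤ : Submodule R M) := by
    intro m
    rw [← Submodule.Quotient.mk_eq_zero]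
    change q (r • m - B (A m)) = 0
    have h₁ := LinearMap.congr_fun hab (q m)
    have h₂ : (fun i => Ideal.Quotient.mk (Ideal.span {x}) (A m i)) = a (q m) :=
      funext fun i => hψ i m
    rw [map_sub, hB, h₂, map_smul, sub_eq_zero]
    exact h₁
  have hg : ∀ m, ∃ m', x • m' = (r • LinearMap.id - B ∘ₗ A : M →ₗ[R] M) m := fun m => by
    obtain ⟨m', -, h⟩ := (Submodule.mem_smul_pointwise_iff_exists _ _ _).1 (hmem m)
    exact ⟨m', h⟩
  -- Regularity of `x` makes the quotient by `x` unique, hence linear.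
  choose g hg using hg
  let G : M →ₗ[R] M :=
    { toFun := g
      map_add' := fun m m' => hreg (by
        change x • g _ = x • (g _ + g _)
        rw [smul_add, hg, hg, hg, map_add])
      map_smul' := fun s m => hreg (by
        change x • g _ = x • s • g _
        rw [smul_comm, hg, hg, map_smul]) }
  have hdecomp : r • LinearMap.id = B ∘ₗ A + (x • LinearMap.id) ∘ₗ G := by
    rw [← sub_eq_iff_eq_add']
    exact LinearMap.ext fun m => (hg m).symm
  rw [hdecomp]
  refine add_mem ?_ (comp_mem_projectiveHom_of_left hxM G)
  exact ⟨Fin n → R, inferInstance, inferInstance, inferInstance, inferInstance, A, B, rfl⟩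

end Stable

/-! ### Comparison of stable annihilators and continuity of reduction -/

section Main

variable {R : Type u} [CommRing R]

/-- Over a Gorenstein local ring, `Ext^1(M, R) = 0` for maximal Cohen-Macaulay `M`. -/
theorem IsMaximalCohenMacaulay.subsingleton_ext_one [IsGorensteinLocalRing R]
    {M : Type u} [AddCommGroup M] [Module R M] (hM : IsMaximalCohenMacaulay R M) :
    Subsingleton (Abelian.Ext (ModuleCat.of R M) (ModuleCat.of R R) 1) := by
  have := hM.finite
  obtain _ | _ := subsingleton_or_nontrivial M
  · exact subsingleton_ext_of_isZero (ModuleCat.isZero_of_subsingleton _)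
  obtain ⟨n, hn⟩ := IsGorensteinLocalRing.exists_hasInjectiveDimensionLE (R := R)
  obtain ⟨d, hd⟩ := exists_ringKrullDim_eq_natCast (R := R)
  obtain ⟨rs, hmem, hrs, hdim⟩ := hM.exists_isRegular
  have hlen : d ≤ rs.length := by
    rw [hd] at hdim
    exact_mod_cast hdim
  refine subsingleton_ext_of_isRegular rs hmem (fun L hL => ?_) _ hrs
  exact subsingleton_ext_self_of_ringKrullDim_lt hd (N := n + 1)
    (fun i hi L _ => HasInjectiveDimensionLT.subsingleton _ (n + 1) i hi L) (by lia) L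

/-- For a maximal Cohen-Macaulay module `M` over a Gorenstein local ring and a nonzerodivisor `x`
in the stable annihilator of `M`, the stable annihilator of `M / xM` is that of `M` modulo `x`. -/
theorem mk_mem_stableAnnihilator_quotSMulTop_iff [IsGorensteinLocalRing R]
    {M : Type u} [AddCommGroup M] [Module R M] (hM : IsMaximalCohenMacaulay R M) {x : R}
    (hx : x ∈ nonZeroDivisors R) (hxM : x ∈ stableAnnihilator R M) {r : R} :
    Ideal.Quotient.mk (Ideal.span {x}) r ∈
      stableAnnihilator (R ⧸ Ideal.span {x}) (QuotSMulTop x M) ↔ r ∈ stableAnnihilator R M :=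
  ⟨mem_stableAnnihilator_of_mk_mem hM.subsingleton_ext_one hx (hM.isSMulRegular hx) hxM,
    mk_mem_stableAnnihilator_quotSMulTop x⟩

theorem stableAnnihilator_quotSMulTop_le [IsGorensteinLocalRing R] {L M : Type u}
    [AddCommGroup L] [Module R L] [AddCommGroup M] [Module R M]
    (hL : IsMaximalCohenMacaulay R L) {x : R}
    (hx : x ∈ nonZeroDivisors R) (hxL : x ∈ stableAnnihilator R L)
    (h : stableAnnihilator R L ≤ stableAnnihilator R M) :
    stableAnnihilator (R ⧸ Ideal.span {x}) (QuotSMulTop x L) ≤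
      stableAnnihilator (R ⧸ Ideal.span {x}) (QuotSMulTop x M) := by
  intro r hr
  obtain ⟨r, rfl⟩ := Ideal.Quotient.mk_surjective r
  exact mk_mem_stableAnnihilator_quotSMulTop x
    (h ((mk_mem_stableAnnihilator_quotSMulTop_iff hL hx hxL).1 hr))

/-- Isomorphic objects of the stable category reduce to isomorphic objects modulo `x`. -/
theorem StableMCM.isIsomorphic_quotSMulTop [IsLocalRing R] {x : R}
    [IsLocalRing (R ⧸ Ideal.span {x})] {L M : StableMCM R}
    (hL : IsMaximalCohenMacaulay (R ⧸ Ideal.span {x}) (QuotSMulTop x L.carrier))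
    (hM : IsMaximalCohenMacaulay (R ⧸ Ideal.span {x}) (QuotSMulTop x M.carrier))
    (e : L ≅ M) :
    IsIsomorphic (⟨QuotSMulTop x L.carrier, hL⟩ : StableMCM (R ⧸ Ideal.span {x}))
      ⟨QuotSMulTop x M.carrier, hM⟩ := by
  obtain ⟨f, hf⟩ := Submodule.Quotient.mk_surjective _ e.hom
  obtain ⟨g, hg⟩ := Submodule.Quotient.mk_surjective _ e.inv
  -- Stable inverses are inverse only up to maps factoring through projectives; reduction modulo `x`
  -- preserves such maps.
  have key : ∀ {A B : Type u} [AddCommGroup A] [Module R A] [AddCommGroup B] [Module R B]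
      (f : A →ₗ[R] B) (g : B →ₗ[R] A), g ∘ₗ f - LinearMap.id ∈ projectiveHom R A A →
      (Submodule.Quotient.mk (quotSMulTopMap x g ∘ₗ quotSMulTopMap x f) :
        StableHom (R ⧸ Ideal.span {x}) (QuotSMulTop x A) (QuotSMulTop x A)) =
      Submodule.Quotient.mk LinearMap.id := fun f g h => by
    rw [Submodule.Quotient.eq, ← quotSMulTopMap_comp, ← quotSMulTopMap_id, ← quotSMulTopMap_sub]
    exact quotSMulTopMap_mem_projectiveHom x h
  have h₁ : g ∘ₗ f - LinearMap.id ∈ projectiveHom R _ _ := by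
    have h := e.hom_inv_id
    rw [← hf, ← hg] at h
    exact (Submodule.Quotient.eq _).1 h
  have h₂ : f ∘ₗ g - LinearMap.id ∈ projectiveHom R _ _ := by
    have h := e.inv_hom_id
    rw [← hf, ← hg] at h
    exact (Submodule.Quotient.eq _).1 h
  exact ⟨{ hom := Submodule.Quotient.mk (quotSMulTopMap x f)
           inv := Submodule.Quotient.mk (quotSMulTopMap x g)
           hom_inv_id := key f g h₁
           inv_hom_id := key g f h₂ }⟩

/-- The map `M ↦ M / xM` on the spaces of maximal Cohen-Macaulay modules. -/
noncomputable def CMSpace.quotSMulTop [IsLocalRing R] (x : R) [IsLocalRing (R ⧸ Ideal.span {x})]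
    (hMCM : ∀ (M : Type u) [AddCommGroup M] [Module R M], IsMaximalCohenMacaulay R M →
        IsMaximalCohenMacaulay (R ⧸ Ideal.span {x}) (QuotSMulTop x M)) :
    CMSpace R → CMSpace (R ⧸ Ideal.span {x}) :=
  Quotient.lift (fun M : StableMCM R =>
      CMSpace.mk (QuotSMulTop x M.carrier) (hMCM M.carrier M.isMaximalCohenMacaulay))
    fun _ _ ⟨e⟩ => Quotient.sound (StableMCM.isIsomorphic_quotSMulTop _ _ e)

/-- Maps of Alexandrov spaces that are monotone for the orders by annihilators are continuous. -/
theorem CMSpace.continuous_of_monotone {S : Type u} [CommRing S] [IsLocalRing R] [IsLocalRing S]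
    {π : CMSpace R → CMSpace S}
    (h : ∀ a b, AlexandrovSpace.ann R _ a ≤ AlexandrovSpace.ann R _ b →
      AlexandrovSpace.ann S _ (π a) ≤ AlexandrovSpace.ann S _ (π b)) : Continuous π :=
  continuous_def.2 fun _ hs a b hab ha => hs (h a b hab) ha

end Main

theorem theorem3p3 {R : Type u} [CommRing R] [IsGorensteinLocalRing R] (x : R)
    [Nontrivial (R ⧸ Ideal.span {x})]
    (hx : x ∈ cohomologyAnnihilator R) (hreg : x ∈ nonZeroDivisors R) :
    IsGorensteinLocalRing (R ⧸ Ideal.span {x}) ∧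
    ∃ hMCM : ∀ (M : Type u) [AddCommGroup M] [Module R M], IsMaximalCohenMacaulay R M →
        IsMaximalCohenMacaulay (R ⧸ Ideal.span {x}) (QuotSMulTop x M),
      (∃ π : CMSpace R → CMSpace (R ⧸ Ideal.span {x}),
        (∀ (M : Type u) [AddCommGroup M] [Module R M] (hM : IsMaximalCohenMacaulay R M),
          π (CMSpace.mk M hM) = CMSpace.mk (QuotSMulTop x M) (hMCM M hM)) ∧
        Continuous π) ∧
      ∀ (L M : Type u) [AddCommGroup L] [Module R L] [AddCommGroup M] [Module R M],
        IsMaximalCohenMacaulay R L → IsMaximalCohenMacaulay R M →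
        stableAnnihilator R L ≤ stableAnnihilator R M →
        stableAnnihilator (R ⧸ Ideal.span {x}) (QuotSMulTop x L) ≤
          stableAnnihilator (R ⧸ Ideal.span {x}) (QuotSMulTop x M) := by
  -- Membership in `ca(R)` serves to make `x` stably annihilate every MCM module at once, so one `x`
  -- handles all points.
  have hann : ∀ (M : Type u) [AddCommGroup M] [Module R M], IsMaximalCohenMacaulay R M →
      x ∈ stableAnnihilator R M := fun M _ _ hM =>
    (Submodule.mem_iInf _).1 hx (⟨M, hM⟩ : StableMCM R)
  refine ⟨IsGorensteinLocalRing.quotient_span_singleton hreg, fun M _ _ hM => hM.quotSMulTop hreg,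
    ⟨CMSpace.quotSMulTop x fun M _ _ hM => hM.quotSMulTop hreg, fun M _ _ hM => rfl,
      CMSpace.continuous_of_monotone ?_⟩,
    fun L M _ _ _ _ hL _ h => stableAnnihilator_quotSMulTop_le hL hreg (hann L hL) h⟩
  rintro ⟨L⟩ ⟨M⟩ h
  exact stableAnnihilator_quotSMulTop_le L.isMaximalCohenMacaulay hreg
    (hann _ L.isMaximalCohenMacaulay) h
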